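/- Let $n\in\mathbb N$ and let $H_1,H_2$ be $n\times n$ transfer matrices in $\mathcal{RH}_\infty$, i.e. matrices of proper rational functions of $s$ with real coefficients and with no poles in the closed right half-plane $\operatorname{Re}s\ge 0$; write $H_i(j\infty)=\lim_{|s|\to\infty}H_i(s)$. For $A\in\mathbb C^{n\times n}$ let $$\sigma_{\max}(A)=\max_{\|u\|=1}\|Au\|,\qquad \hat\alpha_{\max}(A)=\sup_{\|u\|=1,\ Au\neq 0}\arccos\frac{\operatorname{Re}\langle Au,u\rangle}{\|Au\|\,\|u\|},$$ with Euclidean norms on $\mathbb C^n$ and $\hat\alpha_{\max}(0)=0$. Suppose that for each frequency $\omega\in[0,\infty]$ at least one of the following holds: 1. (phase condition) $\hat\alpha_{\max}(H_1(j\omega))+\hat\alpha_{\max}(H_2(j\omega))<\pi$; 2. (gain condition) $\sigma_{\max}(H_1(j\omega))\,\sigma_{\max}(H_2(j\omega))<1$. Then the negative feedback interconnection $y=H_1e$, $e=u-H_2y$ is $\mathcal L_2$-stable: for $F=\mathbb R$ and for $F=\mathbb C$ there is $\gamma\ge 0$ such that for every input $u\in\mathcal L_2([0,\infty);F^n)$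 there are unique $e,y\in\mathcal L_2([0,\infty);F^n)$ satisfying the loop equations, and $\|e\|\le\gamma\|u\|$, $\|y\|\le\gamma\|u\|$. Here, for $\mathcal L_2$ signals $v,w$, the equation $w=H_iv$ means that the Laplace transforms satisfy $\hat w(s)=H_i(s)\hat v(s)$ for all $\operatorname{Re}s>0$. -/

import Mathlib

open scoped ENNReal NNReal

noncomputable section

namespace MixedGainPhase

/-! ### Transfer matrices -/

/-- Real-rational square transfer matrices `H(s)`. -/
abbrev TransferMatrix (n : ℕ) : Type := Matrix (Fin n) (Fin n) (RatFunc ℝ)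

/-- The space `RH∞`: every entry is proper and has no pole in the closed right half-plane
(`num` and `denom` are coprime and `denom` is monic). -/
def IsRHInf {n : ℕ} (H : TransferMatrix n) : Prop :=
  ∀ i j, (H i j).num.natDegree ≤ (H i j).denom.natDegree ∧
    ∀ s : ℂ, 0 ≤ s.re → Polynomial.aeval s (H i j).denom ≠ 0

/-- The value `H(s)` at a complex point `s` that is not a pole. -/
def evalAt {n : ℕ} (H : TransferMatrix n) (s : ℂ) : Matrix (Fin n) (Fin n) ℂ :=
  H.map (RatFunc.eval (algebraMap ℝ ℂ) s)

/-- The value `H(j∞) = lim_{|s| → ∞} H(s)` of a proper transfer matrix: since `denom` is monic,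
the limit of an entry is the coefficient of `num` at the degree of `denom`. -/
def valueAtInfinity {n : ℕ} (H : TransferMatrix n) : Matrix (Fin n) (Fin n) ℂ :=
  H.map fun r => ((r.num.coeff r.denom.natDegree : ℝ) : ℂ)

/-- The frequency response `H(jω)` at a frequency `ω ∈ [0, ∞]`. -/
def freqResponse {n : ℕ} (H : TransferMatrix n) (ω : ℝ≥0∞) : Matrix (Fin n) (Fin n) ℂ :=
  if ω = ∞ then valueAtInfinity H else evalAt H (Complex.I * (ω.toReal : ℂ))

/-! ### Maximum gain and maximum phase of a matrix -/

/-- `σ_max(A)`, the maximum of `‖Au‖` over unit vectors `u`. -/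
def sigmaMax {n : ℕ} (A : Matrix (Fin n) (Fin n) ℂ) : ℝ :=
  sSup {r : ℝ | ∃ u : EuclideanSpace ℂ (Fin n), ‖u‖ = 1 ∧ r = ‖Matrix.toEuclideanLin A u‖ / ‖u‖}

/-- `α̂_max(A)`, the supremum of the angles between `u` and `Au` over unit vectors `u` with
`Au ≠ 0`. If there is no such `u`, the set is empty and the value is `0`. -/
def alphaMax {n : ℕ} (A : Matrix (Fin n) (Fin n) ℂ) : ℝ :=
  sSup {θ : ℝ | ∃ u : EuclideanSpace ℂ (Fin n), ‖u‖ = 1 ∧ ‖Matrix.toEuclideanLin A u‖ ≠ 0 ∧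
    θ = Real.arccos ((inner ℂ (Matrix.toEuclideanLin A u) u).re /
      (‖Matrix.toEuclideanLin A u‖ * ‖u‖))}

/-! ### Signals on the time axis `[0, ∞)` and `L₂`-stability -/

/-- Lebesgue measure on the time axis `[0, ∞)`. -/
def timeMeasure : MeasureTheory.Measure ℝ :=
  MeasureTheory.volume.restrict (Set.Ici 0)

/-- The inclusion `Fⁿ ⊆ ℂⁿ` for `F = ℝ` or `F = ℂ`. -/
def toComplexVec {F : Type} [RCLike F] {n : ℕ} (v : EuclideanSpace F (Fin n)) :
    EuclideanSpace ℂ (Fin n) :=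
  WithLp.toLp 2 fun i => ((RCLike.re (v i) : ℝ) : ℂ) + ((RCLike.im (v i) : ℝ) : ℂ) * Complex.I

/-- The Laplace transform `∫₀^∞ e^{-st} u(t) dt`. For `u ∈ L₂` and `Re s > 0` the integral
converges absolutely. -/
def laplace {F : Type} [RCLike F] {n : ℕ} (u : ℝ → EuclideanSpace F (Fin n)) (s : ℂ) :
    EuclideanSpace ℂ (Fin n) :=
  ∫ t, Complex.exp (-(s * (t : ℂ))) • toComplexVec (u t) ∂timeMeasure

/-- The `L₂` signal `y` is the output of the causal LTI system with transfer matrix `H` for the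
`L₂` input `u`: the transforms satisfy `ŷ(s) = H(s) û(s)` on the open right half-plane. -/
def IsResponse {F : Type} [RCLike F] {n : ℕ} (H : TransferMatrix n)
    (u y : ℝ → EuclideanSpace F (Fin n)) : Prop :=
  ∀ s : ℂ, 0 < s.re → laplace y s = Matrix.toEuclideanLin (evalAt H s) (laplace u s)

/-- The `L₂` signals `e`, `y` solve the negative feedback loop with external input `u`:
`y = H₁ e` and `e = u - w`, where `w = H₂ y`. -/
structure IsLoopSolution {F : Type} [RCLike F] {n : ℕ} (H₁ H₂ : TransferMatrix n)
    (u e y : ℝ → EuclideanSpace F (Fin n)) : Prop where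
  memLp_error : MeasureTheory.MemLp e 2 timeMeasure
  memLp_output : MeasureTheory.MemLp y 2 timeMeasure
  forward : IsResponse H₁ e y
  feedback : ∃ w : ℝ → EuclideanSpace F (Fin n), MeasureTheory.MemLp w 2 timeMeasure ∧
    IsResponse H₂ y w ∧ ∀ᵐ t ∂timeMeasure, e t = u t - w t

/-- `L₂`-stability over `F`: every input `u ∈ L₂` produces a unique pair of `L₂` loop signals
(up to null sets), and these are bounded by a fixed multiple of the norm of `u`. -/
def IsL2StableOver (F : Type) [RCLike F] {n : ℕ} (H₁ H₂ : TransferMatrix n) : Prop :=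
  ∃ γ : ℝ≥0, ∀ u : ℝ → EuclideanSpace F (Fin n), MeasureTheory.MemLp u 2 timeMeasure →
    ∃ e y : ℝ → EuclideanSpace F (Fin n), IsLoopSolution H₁ H₂ u e y ∧
      MeasureTheory.eLpNorm e 2 timeMeasure ≤ γ * MeasureTheory.eLpNorm u 2 timeMeasure ∧
      MeasureTheory.eLpNorm y 2 timeMeasure ≤ γ * MeasureTheory.eLpNorm u 2 timeMeasure ∧
      ∀ e' y' : ℝ → EuclideanSpace F (Fin n), IsLoopSolution H₁ H₂ u e' y' →
        e' =ᵐ[timeMeasure] e ∧ y' =ᵐ[timeMeasure] y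

/-- The closed loop is `L₂`-stable, for real and for complex signals. -/
def IsClosedLoopL2Stable {n : ℕ} (H₁ H₂ : TransferMatrix n) : Prop :=
  IsL2StableOver ℝ H₁ H₂ ∧ IsL2StableOver ℂ H₁ H₂

end MixedGainPhase

end

namespace MixedGainPhase

/-! ### Invertibility of the return difference at a single frequency -/

section

open Matrix Complex

variable {n : ℕ}

/-! At a fixed frequency, a kernel vector `e` of `1 + t H₂ H₁` with `t ∈ [0, 1]` is a loop signal:
`e = -t w`, with `y = H₁ e` and `w = H₂ y`. Small gain forbids this by comparing norms. Small phase
forbids it because `w` points opposite to `e`, so the angles of the pairs `(e, y)` and `(y, w)` add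
up to exactly `π` (`pi_le_alphaMax_add_alphaMax`). Each condition covers all `t ∈ [0, 1]`, so the
two may alternate between frequencies.

A homotopy replaces the Nyquist criterion (`det_one_add_ne_zero_of_imaginary`). On the imaginary
axis and at infinity, `|det (1 + t H₂ H₁)|` has a lower bound `c > 0` uniform in `t`. While the
determinant is zero-free on the closed right half-plane, the minimum principle extends this bound
inside; uniform continuity in `t` then gives a step length that does not shrink, so zero-freeness
passes from `t = 0` to `t = 1`.

Hence `(1 + H₂ H₁)⁻¹` is again proper and stable, and such functions act boundedly on `L₂`
(`IsProperStable.isRealizable`): they are built from constants and first-order lags, which are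
convolutions with decaying exponentials. Injectivity of the Laplace transform on `L₂` gives
uniqueness. -/

lemma arccos_le_alphaMax (A : Matrix (Fin n) (Fin n) ℂ) {v : EuclideanSpace ℂ (Fin n)}
    (hv : v ≠ 0) (hAv : toEuclideanLin A v ≠ 0) :
    Real.arccos ((inner ℂ (toEuclideanLin A v) v).re / (‖toEuclideanLin A v‖ * ‖v‖)) ≤
      alphaMax A := by
  have hv' : ‖v‖ ≠ 0 := norm_ne_zero_iff.2 hv
  have hA' : ‖toEuclideanLin A v‖ ≠ 0 := norm_ne_zero_iff.2 hAv
  refine le_csSup ⟨Real.pi, ?_⟩ ⟨((‖v‖⁻¹ : ℝ) : ℂ) • v, ?_, ?_, ?_⟩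
  · rintro _ ⟨u, -, -, rfl⟩
    exact Real.arccos_le_pi _
  · rw [norm_smul]; simp [hv']
  · rw [map_smul, norm_smul]; simp [hv', hAv]
  · congr 1
    rw [map_smul, norm_smul, norm_smul, inner_smul_left, inner_smul_right, conj_ofReal,
      re_ofReal_mul, re_ofReal_mul]
    simp only [norm_real, norm_inv, norm_norm]
    field_simp

lemma bddAbove_gains (A : Matrix (Fin n) (Fin n) ℂ) :
    BddAbove {r : ℝ | ∃ u : EuclideanSpace ℂ (Fin n), ‖u‖ = 1 ∧
      r = ‖toEuclideanLin A u‖ / ‖u‖} := by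
  refine ⟨‖LinearMap.toContinuousLinearMap (toEuclideanLin A)‖, ?_⟩
  rintro _ ⟨u, hu, rfl⟩
  simpa [hu] using (LinearMap.toContinuousLinearMap (toEuclideanLin A)).le_opNorm u

lemma norm_le_sigmaMax (A : Matrix (Fin n) (Fin n) ℂ) (v : EuclideanSpace ℂ (Fin n)) :
    ‖toEuclideanLin A v‖ ≤ sigmaMax A * ‖v‖ := by
  rcases eq_or_ne v 0 with rfl | hv
  · simp
  have hv' : ‖v‖ ≠ 0 := norm_ne_zero_iff.2 hv
  rw [← div_le_iff₀ (norm_pos_iff.2 hv)]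
  refine le_csSup (bddAbove_gains A) ⟨((‖v‖⁻¹ : ℝ) : ℂ) • v, ?_, ?_⟩
  · rw [norm_smul]; simp [hv']
  · rw [map_smul, norm_smul, norm_smul]
    simp only [norm_real, norm_inv, norm_norm]
    field_simp

lemma sigmaMax_nonneg (A : Matrix (Fin n) (Fin n) ℂ) : 0 ≤ sigmaMax A := by
  refine Real.sSup_nonneg ?_
  rintro _ ⟨u, -, rfl⟩
  positivity

/-- Since `w` is a negative multiple of `e`, the cosine of the angle between `w` and `y` is minus
that between `y` and `e`, and `arccos (-x) = π - arccos x`. -/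
lemma pi_le_alphaMax_add_alphaMax (A₁ A₂ : Matrix (Fin n) (Fin n) ℂ) {t : ℝ} (ht : 0 < t)
    {e : EuclideanSpace ℂ (Fin n)} (he : e ≠ 0)
    (h : e = -((t : ℂ) • toEuclideanLin A₂ (toEuclideanLin A₁ e))) :
    Real.pi ≤ alphaMax A₁ + alphaMax A₂ := by
  set y := toEuclideanLin A₁ e with hy
  set w := toEuclideanLin A₂ y with hw
  have hw0 : w ≠ 0 := by
    intro h0
    rw [h0] at h
    exact he (by simpa using h)
  have hy0 : y ≠ 0 := by
    intro h0
    rw [h0, map_zero] at hw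
    exact hw0 hw
  have h1 := arccos_le_alphaMax A₁ he hy0
  have h2 := arccos_le_alphaMax A₂ hy0 hw0
  rw [← hy] at h1
  rw [← hw] at h2
  have hn : ‖e‖ = t * ‖w‖ := by
    rw [h, norm_neg, norm_smul, norm_real, Real.norm_of_nonneg ht.le]
  have hi : (inner ℂ y e).re = -(t * (inner ℂ w y).re) := by
    rw [h, inner_neg_right, inner_smul_right, neg_re, re_ofReal_mul, ← inner_conj_symm, conj_re]
  have hq : (inner ℂ w y).re / (‖w‖ * ‖y‖) = -((inner ℂ y e).re / (‖y‖ * ‖e‖)) := by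
    have := norm_ne_zero_iff.2 hw0
    have := norm_ne_zero_iff.2 hy0
    rw [hi, hn]
    field_simp
  rw [hq, Real.arccos_neg] at h2
  linarith

/-- Under the gain or the phase condition, the return difference is invertible along the whole
homotopy `t ∈ [0, 1]`. -/
lemma det_one_add_smul_mul_ne_zero (A₁ A₂ : Matrix (Fin n) (Fin n) ℂ)
    (h : alphaMax A₁ + alphaMax A₂ < Real.pi ∨ sigmaMax A₁ * sigmaMax A₂ < 1)
    {t : ℝ} (ht : t ∈ Set.Icc (0 : ℝ) 1) : (1 + (t : ℂ) • (A₂ * A₁)).det ≠ 0 := by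
  intro hdet
  obtain ⟨v, hv, hv'⟩ := exists_mulVec_eq_zero_iff.2 hdet
  set e : EuclideanSpace ℂ (Fin n) := WithLp.toLp 2 v with he
  have he0 : e ≠ 0 := by
    simpa [he] using hv
  have hloop : e = -((t : ℂ) • toEuclideanLin A₂ (toEuclideanLin A₁ e)) := by
    rw [add_mulVec, one_mulVec, smul_mulVec, ← mulVec_mulVec] at hv'
    ext i
    have := congrFun hv' i
    simp only [Pi.add_apply, Pi.smul_apply, Pi.zero_apply] at this
    simp only [PiLp.neg_apply, PiLp.smul_apply, toLpLin_apply, he]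
    exact eq_neg_of_add_eq_zero_left this
  have ht0 : 0 < t := by
    refine lt_of_le_of_ne ht.1 ?_
    rintro rfl
    exact he0 (by simpa using hloop)
  rcases h with h | h
  · exact absurd (pi_le_alphaMax_add_alphaMax A₁ A₂ ht0 he0 hloop) (not_le.2 h)
  -- Small gain: `‖e‖ = t ‖A₂ A₁ e‖ ≤ σ₂ σ₁ ‖e‖ < ‖e‖`.
  · have hpos := norm_pos_iff.2 he0
    have h1 := norm_le_sigmaMax A₁ e
    have h2 := norm_le_sigmaMax A₂ (toEuclideanLin A₁ e)
    have h3 : ‖e‖ = t * ‖toEuclideanLin A₂ (toEuclideanLin A₁ e)‖ := by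
      conv_lhs => rw [hloop]
      rw [norm_neg, norm_smul, norm_real, Real.norm_of_nonneg ht0.le]
    have h4 := mul_le_mul_of_nonneg_left h1 (sigmaMax_nonneg A₂)
    have h5 := mul_le_of_le_one_left (norm_nonneg (toEuclideanLin A₂ (toEuclideanLin A₁ e))) ht.2
    have h6 := mul_lt_mul_of_pos_right h hpos
    nlinarith

end

/-! ### Proper stable rational functions on the closed right half-plane -/

section

open Matrix Complex Filter Topology Bornology

/-- The closed right half-plane. -/
def closedRHP : Set ℂ := {s | 0 ≤ s.re}

lemma isClosed_closedRHP : IsClosed closedRHP := isClosed_le continuous_const continuous_re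

/-- The positive real axis is a path to infinity inside the half-plane; it serves to compare limits
there and to bound functions along the reals. -/
lemma tendsto_ofReal_closedRHP :
    Tendsto (fun x : ℝ => (x : ℂ)) atTop (cobounded ℂ ⊓ 𝓟 closedRHP) := by
  refine tendsto_inf.2 ⟨?_, tendsto_principal.2 ?_⟩
  · rw [← tendsto_norm_atTop_iff_cobounded]
    simpa using tendsto_abs_atTop_atTop
  · filter_upwards [eventually_ge_atTop 0] with x hx
    simpa [closedRHP] using hx

/-- Functions that agree on the closed right half-plane with a proper rational function without
poles there. -/
def IsProperStable (φ : ℂ → ℂ) : Prop :=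
  ∃ p q : Polynomial ℂ, p.natDegree ≤ q.natDegree ∧ (∀ s ∈ closedRHP, q.eval s ≠ 0) ∧
    ∀ s ∈ closedRHP, φ s = p.eval s / q.eval s

lemma ne_zero_of_eval_ne_zero {q : Polynomial ℂ} (hq : ∀ s ∈ closedRHP, q.eval s ≠ 0) : q ≠ 0 := by
  rintro rfl
  exact hq 0 (by simp [closedRHP]) (by simp)

/-- With `N = deg q`, write `r(s) = s ^ N * r*(1/s)` for the reflection `r*` at `N`; the powers
cancel and `1/s → 0` leaves the coefficients at `N`. -/
lemma tendsto_eval_div_eval_cobounded {p q : Polynomial ℂ} (hpq : p.natDegree ≤ q.natDegree)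
    (hq : q ≠ 0) :
    Tendsto (fun s => p.eval s / q.eval s) (cobounded ℂ)
      (𝓝 (p.coeff q.natDegree / q.leadingCoeff)) := by
  set N := q.natDegree with hN
  have key : ∀ r : Polynomial ℂ, r.natDegree ≤ N → ∀ s : ℂ, s ≠ 0 →
      r.eval s = (r.reflect N).eval s⁻¹ * s ^ N := by
    intro r hr s hs
    have : Invertible s := invertibleOfNonzero hs
    have := Polynomial.eval₂_reflect_mul_pow (RingHom.id ℂ) s N r hr
    simpa [Polynomial.eval₂_eq_eval_map] using this.symm
  have h0 : ∀ r : Polynomial ℂ,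
      Tendsto (fun s : ℂ => (r.reflect N).eval s⁻¹) (cobounded ℂ) (𝓝 (r.coeff N)) := by
    intro r
    have h1 : (r.reflect N).eval 0 = r.coeff N := by
      rw [← Polynomial.coeff_zero_eq_eval_zero, Polynomial.coeff_reflect,
        Polynomial.revAt_le (Nat.zero_le _), Nat.sub_zero]
    rw [← h1]
    exact ((r.reflect N).continuous.tendsto 0).comp tendsto_inv₀_cobounded
  refine ((h0 p).div (h0 q) (by simpa [hN] using hq)).congr' ?_
  filter_upwards [eventually_ne_cobounded (0 : ℂ)] with s hs
  rw [key p hpq s hs, key q le_rfl s hs, mul_div_mul_right _ _ (pow_ne_zero _ hs)]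
  rfl

namespace IsProperStable

variable {φ ψ : ℂ → ℂ}

lemma const (c : ℂ) : IsProperStable fun _ => c :=
  ⟨.C c, 1, by simp, by simp, by simp⟩

lemma add (hφ : IsProperStable φ) (hψ : IsProperStable ψ) :
    IsProperStable fun s => φ s + ψ s := by
  obtain ⟨p, q, hd, hq, h⟩ := hφ
  obtain ⟨p', q', hd', hq', h'⟩ := hψ
  refine ⟨p * q' + p' * q, q * q', ?_, ?_, ?_⟩
  · rw [Polynomial.natDegree_mul (ne_zero_of_eval_ne_zero hq) (ne_zero_of_eval_ne_zero hq')]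
    refine (Polynomial.natDegree_add_le _ _).trans (max_le ?_ ?_)
    · exact Polynomial.natDegree_mul_le.trans (by omega)
    · exact Polynomial.natDegree_mul_le.trans (by omega)
  · intro s hs
    simpa using ⟨hq s hs, hq' s hs⟩
  · intro s hs
    have h1 := hq s hs
    have h2 := hq' s hs
    simp only [h s hs, h' s hs, Polynomial.eval_add, Polynomial.eval_mul]
    field_simp

lemma mul (hφ : IsProperStable φ) (hψ : IsProperStable ψ) :
    IsProperStable fun s => φ s * ψ s := by
  obtain ⟨p, q, hd, hq, h⟩ := hφ
  obtain ⟨p', q', hd', hq', h'⟩ := hψ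
  refine ⟨p * p', q * q', ?_, ?_, ?_⟩
  · rw [Polynomial.natDegree_mul (ne_zero_of_eval_ne_zero hq) (ne_zero_of_eval_ne_zero hq')]
    exact Polynomial.natDegree_mul_le.trans (by omega)
  · intro s hs
    simpa using ⟨hq s hs, hq' s hs⟩
  · intro s hs
    simp only [h s hs, h' s hs, Polynomial.eval_mul]
    rw [div_mul_div_comm]

lemma sum {ι : Type*} (S : Finset ι) {f : ι → ℂ → ℂ} (hf : ∀ i ∈ S, IsProperStable (f i)) :
    IsProperStable fun s => ∑ i ∈ S, f i s := by
  classical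
  induction S using Finset.induction_on with
  | empty => simpa using const 0
  | insert a S ha ih =>
    simp only [Finset.sum_insert ha]
    exact (hf a (by simp)).add (ih fun i hi => hf i (by simp [hi]))

lemma prod {ι : Type*} (S : Finset ι) {f : ι → ℂ → ℂ} (hf : ∀ i ∈ S, IsProperStable (f i)) :
    IsProperStable fun s => ∏ i ∈ S, f i s := by
  classical
  induction S using Finset.induction_on with
  | empty => simpa using const 1
  | insert a S ha ih =>
    simp only [Finset.prod_insert ha]
    exact (hf a (by simp)).mul (ih fun i hi => hf i (by simp [hi]))

lemma det {m : ℕ} {M : ℂ → Matrix (Fin m) (Fin m) ℂ}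
    (hM : ∀ i j, IsProperStable fun s => M s i j) : IsProperStable fun s => (M s).det := by
  simp only [det_apply']
  exact sum _ fun σ _ => (const _).mul (prod _ fun i _ => hM _ _)

lemma adjugate {m : ℕ} {M : ℂ → Matrix (Fin m) (Fin m) ℂ}
    (hM : ∀ i j, IsProperStable fun s => M s i j) (i j : Fin m) :
    IsProperStable fun s => (M s).adjugate i j := by
  simp only [adjugate_apply]
  refine det fun k l => ?_
  by_cases hk : k = j
  · subst hk
    simpa using const _
  · simpa [updateRow_apply, hk] using hM k l

lemma continuousOn (hφ : IsProperStable φ) : ContinuousOn φ closedRHP := by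
  obtain ⟨p, q, hd, hq, h⟩ := hφ
  exact (p.continuous.continuousOn.div q.continuous.continuousOn hq).congr h

lemma differentiableOn (hφ : IsProperStable φ) : DifferentiableOn ℂ φ {s | 0 < s.re} := by
  obtain ⟨p, q, hd, hq, h⟩ := hφ
  have hsub : ∀ s ∈ {s : ℂ | 0 < s.re}, s ∈ closedRHP := fun s (hs : 0 < s.re) => hs.le
  exact (p.differentiable.differentiableOn.div q.differentiable.differentiableOn
    fun s hs => hq s (hsub s hs)).congr fun s hs => h s (hsub s hs)

/-- A nonzero limit makes the coefficient of `p` at `deg q` nonzero, so `deg q ≤ deg p` and `q / p`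
is proper. -/
lemma inv (hφ : IsProperStable φ) (h0 : ∀ s ∈ closedRHP, φ s ≠ 0) {c : ℂ} (hc : c ≠ 0)
    (hlim : Tendsto φ (cobounded ℂ ⊓ 𝓟 closedRHP) (𝓝 c)) :
    IsProperStable fun s => (φ s)⁻¹ := by
  obtain ⟨p, q, hd, hq, h⟩ := hφ
  refine ⟨q, p, ?_, ?_, ?_⟩
  · have hl := (tendsto_eval_div_eval_cobounded hd (ne_zero_of_eval_ne_zero hq)).mono_left
      (inf_le_left : cobounded ℂ ⊓ 𝓟 closedRHP ≤ cobounded ℂ)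
    have hl' : Tendsto φ (cobounded ℂ ⊓ 𝓟 closedRHP)
        (𝓝 (p.coeff q.natDegree / q.leadingCoeff)) := by
      refine hl.congr' ?_
      filter_upwards [mem_inf_of_right (mem_principal_self closedRHP)] with s hs
      exact (h s hs).symm
    have := tendsto_nhds_unique (hlim.comp tendsto_ofReal_closedRHP)
      (hl'.comp tendsto_ofReal_closedRHP)
    refine Polynomial.le_natDegree_of_ne_zero fun hz => hc ?_
    rw [this, hz, zero_div]
  · intro s hs hz
    exact h0 s hs (by rw [h s hs, hz, zero_div])
  · intro s hs
    simp only [h s hs, inv_div]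

end IsProperStable

/-! ### Entries of transfer matrices -/

lemma ratFunc_eval_eq (r : RatFunc ℝ) (s : ℂ) :
    RatFunc.eval (algebraMap ℝ ℂ) s r =
      (r.num.map (algebraMap ℝ ℂ)).eval s / (r.denom.map (algebraMap ℝ ℂ)).eval s := by
  simp [RatFunc.eval, Polynomial.eval₂_eq_eval_map]

variable {n : ℕ}

lemma IsRHInf.isProperStable {H : TransferMatrix n} (hH : IsRHInf H) (i j : Fin n) :
    IsProperStable fun s => evalAt H s i j := by
  refine ⟨(H i j).num.map (algebraMap ℝ ℂ), (H i j).denom.map (algebraMap ℝ ℂ), ?_, ?_, ?_⟩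
  · simpa using (hH i j).1
  · intro s hs
    rw [Polynomial.eval_map, ← Polynomial.aeval_def]
    exact (hH i j).2 s hs
  · intro s _
    simp [evalAt, ratFunc_eval_eq]

lemma IsRHInf.tendsto_evalAt {H : TransferMatrix n} (hH : IsRHInf H) :
    Tendsto (evalAt H) (cobounded ℂ) (𝓝 (valueAtInfinity H)) := by
  refine tendsto_pi_nhds.2 fun i => tendsto_pi_nhds.2 fun j => ?_
  have hd : ((H i j).num.map (algebraMap ℝ ℂ)).natDegree ≤
      ((H i j).denom.map (algebraMap ℝ ℂ)).natDegree := by simpa using (hH i j).1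
  have hm : ((H i j).denom.map (algebraMap ℝ ℂ)).Monic := (RatFunc.monic_denom _).map _
  have := tendsto_eval_div_eval_cobounded hd hm.ne_zero
  rw [hm.leadingCoeff, div_one, Polynomial.coeff_map, Polynomial.natDegree_map] at this
  simpa [evalAt, valueAtInfinity, ratFunc_eval_eq] using this

/-- Real coefficients. This symmetry reaches negative frequencies and lets real inputs produce real
outputs. -/
lemma evalAt_conj (H : TransferMatrix n) (s : ℂ) :
    evalAt H (starRingEnd ℂ s) = (evalAt H s).map (starRingEnd ℂ) := by
  ext i j
  have : ∀ p : Polynomial ℝ, (p.map (algebraMap ℝ ℂ)).eval (starRingEnd ℂ s) =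
      starRingEnd ℂ ((p.map (algebraMap ℝ ℂ)).eval s) := by
    intro p
    rw [← Polynomial.eval₂_eq_eval_map, ← Polynomial.eval₂_eq_eval_map, Polynomial.hom_eval₂]
    congr 1
    ext x
    simp
  simp [evalAt, ratFunc_eval_eq, this]

end

/-! ### Minimum principle and homotopy -/

section

open Matrix Complex Filter Topology Bornology

/-- Minimum principle on the right half-plane. -/
lemma IsProperStable.le_norm_of_le_norm_imaginary {φ : ℂ → ℂ} (hφ : IsProperStable φ)
    (h0 : ∀ s ∈ closedRHP, φ s ≠ 0) {a : ℂ} (ha : a ≠ 0)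
    (hlim : Tendsto φ (cobounded ℂ ⊓ 𝓟 closedRHP) (𝓝 a)) {c : ℝ} (hc : 0 < c)
    (him : ∀ ω : ℝ, c ≤ ‖φ (ω * I)‖) {s : ℂ} (hs : s ∈ closedRHP) : c ≤ ‖φ s‖ := by
  have hinv := hφ.inv h0 ha hlim
  have hlim' : Tendsto (fun s => (φ s)⁻¹) (cobounded ℂ ⊓ 𝓟 closedRHP) (𝓝 a⁻¹) := hlim.inv₀ ha
  have hsub : {z : ℂ | 0 < z.re} ⊆ closedRHP := fun z (hz : 0 < z.re) => hz.le
  have hbound : ‖(φ s)⁻¹‖ ≤ c⁻¹ := by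
    -- Phragmén–Lindelöf for `1 / φ`; both growth parameters can be `0` because `1 / φ` has a finite
    -- limit at infinity.
    refine PhragmenLindelof.right_half_plane_of_bounded_on_real (f := fun s => (φ s)⁻¹) (C := c⁻¹)
      ⟨hinv.differentiableOn, ?_⟩ ⟨0, two_pos, 0, ?_⟩ ?_ ?_ hs
    · rw [closure_setOfPred_lt_re]
      exact hinv.continuousOn
    · simp only [zero_mul, Real.exp_zero]
      exact (hlim'.mono_left (inf_le_inf_left _ (principal_mono.2 hsub))).isBigO_one ℝ
    · exact (hlim'.comp tendsto_ofReal_closedRHP).norm.isBoundedUnder_le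
    · intro x
      rw [norm_inv]
      exact inv_anti₀ hc (him x)
  rw [norm_inv] at hbound
  exact (inv_le_inv₀ (norm_pos_iff.2 (h0 s hs)) hc).1 hbound

variable {n : ℕ}

lemma IsRHInf.isProperStable_mul {H₁ H₂ : TransferMatrix n} (h₁ : IsRHInf H₁) (h₂ : IsRHInf H₂)
    (i j : Fin n) : IsProperStable fun s => (evalAt H₂ s * evalAt H₁ s) i j := by
  simp only [mul_apply]
  exact .sum _ fun k _ => (h₂.isProperStable i k).mul (h₁.isProperStable k j)

lemma IsProperStable.one_add_smul {M : ℂ → Matrix (Fin n) (Fin n) ℂ}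
    (hM : ∀ i j, IsProperStable fun s => M s i j) (t : ℝ) (i j : Fin n) :
    IsProperStable fun s => (1 + (t : ℂ) • M s) i j := by
  simp only [Matrix.add_apply, Matrix.smul_apply, smul_eq_mul]
  exact (const _).add ((const _).mul (hM i j))

/-- If the return difference `1 + t M` is invertible along the imaginary axis and at infinity for
all `t ∈ [0, 1]`, then `1 + M` is invertible on the closed right half-plane. -/
lemma det_one_add_ne_zero_of_imaginary {M : ℂ → Matrix (Fin n) (Fin n) ℂ}
    (hM : ∀ i j, IsProperStable fun s => M s i j) {M' : Matrix (Fin n) (Fin n) ℂ}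
    (hlim : Tendsto M (cobounded ℂ) (𝓝 M'))
    (him : ∀ t ∈ Set.Icc (0 : ℝ) 1, ∀ ω : ℝ, (1 + (t : ℂ) • M (ω * I)).det ≠ 0)
    (hinf : ∀ t ∈ Set.Icc (0 : ℝ) 1, (1 + (t : ℂ) • M').det ≠ 0)
    {s : ℂ} (hs : s ∈ closedRHP) : (1 + M s).det ≠ 0 := by
  set D : ℝ × Matrix (Fin n) (Fin n) ℂ → ℂ := fun x => (1 + (x.1 : ℂ) • x.2).det with hD
  have hDc : Continuous D := by
    refine Continuous.matrix_det ?_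
    exact continuous_const.add ((continuous_ofReal.comp continuous_fst).smul continuous_snd)
  have hMc : ContinuousOn M closedRHP :=
    continuousOn_pi.2 fun i => continuousOn_pi.2 fun j => (hM i j).continuousOn
  -- Adjoining the limit `M'` makes the image of the axis compact, so the nonvanishing `‖D‖` attains
  -- a positive minimum over all `t`.
  obtain ⟨c, hc, hcle⟩ : ∃ c > 0, ∀ t ∈ Set.Icc (0 : ℝ) 1, ∀ ω : ℝ, c ≤ ‖D (t, M (ω * I))‖ := by
    have haxis : Continuous fun ω : ℝ => M (ω * I) :=
      hMc.comp_continuous (by fun_prop) fun ω => by simp [closedRHP]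
    have hcob : Tendsto (fun ω : ℝ => (ω : ℂ) * I) (cocompact ℝ) (cobounded ℂ) := by
      rw [← tendsto_norm_atTop_iff_cobounded]
      have hn : (fun ω : ℝ => ‖(ω : ℂ) * I‖) = norm := by ext; simp
      rw [hn]
      exact tendsto_norm_cocompact_atTop
    have hK := (hlim.comp hcob).isCompact_insert_range_of_cocompact haxis
    obtain ⟨x, hx, hmin⟩ := ((isCompact_Icc (a := (0 : ℝ)) (b := 1)).prod hK).exists_isMinOn
      ⟨(0, M'), ⟨by simp, Set.mem_insert _ _⟩⟩ hDc.norm.continuousOn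
    refine ⟨‖D x‖, norm_pos_iff.2 ?_, fun t ht ω =>
      hmin (Set.mk_mem_prod ht (Set.mem_insert_of_mem _ ⟨ω, rfl⟩))⟩
    obtain ⟨t, A⟩ := x
    obtain ⟨ht, rfl | ⟨ω, rfl⟩⟩ := hx
    · exact hinf t ht
    · exact him t ht ω
  -- The same compactification of the whole half-plane makes `δ` independent of `s`.
  obtain ⟨δ, hδ, hδle⟩ : ∃ δ > 0, ∀ t ∈ Set.Icc (0 : ℝ) 1, ∀ t' ∈ Set.Icc (0 : ℝ) 1,
      |t - t'| < δ → ∀ s ∈ closedRHP, ‖D (t, M s) - D (t', M s)‖ < c := by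
    have hr : Continuous fun s : closedRHP => M s := continuousOn_iff_continuous_domRestrict.1 hMc
    have hcob : Tendsto (fun s : closedRHP => (s : ℂ)) (cocompact closedRHP) (cobounded ℂ) := by
      rw [Metric.cobounded_eq_cocompact]
      exact isClosed_closedRHP.isClosedEmbedding_subtypeVal.tendsto_cocompact
    have hK := (hlim.comp hcob).isCompact_insert_range_of_cocompact hr
    have huc := ((isCompact_Icc (a := (0 : ℝ)) (b := 1)).prod hK).uniformContinuousOn_of_continuous
      hDc.continuousOn
    let _ : NormedAddCommGroup (Matrix (Fin n) (Fin n) ℂ) := Matrix.normedAddCommGroup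
    obtain ⟨δ, hδ, h⟩ := Metric.uniformContinuousOn_iff.1 huc c hc
    refine ⟨δ, hδ, fun t ht t' ht' htt s hs => ?_⟩
    rw [← dist_eq_norm]
    have hmem : M s ∈ insert M' (Set.range fun s : closedRHP => M s) :=
      Set.mem_insert_of_mem _ ⟨⟨s, hs⟩, rfl⟩
    refine h (t, M s) ⟨ht, hmem⟩ (t', M s) ⟨ht', hmem⟩ ?_
    rw [Prod.dist_eq]
    simpa [hδ, Real.dist_eq] using htt
  -- At parameter `t` the bound `c` holds throughout the half-plane, and moving to `t'` changes `D`
  -- by less than `c`.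
  have hstep : ∀ t ∈ Set.Icc (0 : ℝ) 1, (∀ s ∈ closedRHP, D (t, M s) ≠ 0) →
      ∀ t' ∈ Set.Icc (0 : ℝ) 1, |t - t'| < δ → ∀ s ∈ closedRHP, D (t', M s) ≠ 0 := by
    intro t ht hne t' ht' htt s hs h0
    have hle : c ≤ ‖D (t, M s)‖ := by
      refine (IsProperStable.det (IsProperStable.one_add_smul hM t)).le_norm_of_le_norm_imaginary
        hne (hinf t ht) ?_ hc (hcle t ht) hs
      have : Tendsto (fun s => D (t, M s)) (cobounded ℂ) (𝓝 (D (t, M'))) :=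
        (hDc.tendsto (t, M')).comp (tendsto_const_nhds.prodMk_nhds hlim)
      exact this.mono_left inf_le_left
    have := hδle t ht t' ht' htt s hs
    rw [h0, sub_zero] at this
    exact absurd hle (not_le.2 this)
  obtain ⟨N, hN⟩ := exists_nat_gt (1 / δ)
  have hN0 : (0 : ℝ) < N := lt_trans (by positivity) hN
  have hind : ∀ k : ℕ, k ≤ N → ∀ s ∈ closedRHP, D ((k : ℝ) / N, M s) ≠ 0 := by
    have hmem : ∀ k : ℕ, k ≤ N → (k : ℝ) / N ∈ Set.Icc (0 : ℝ) 1 := fun k hk =>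
      ⟨by positivity, (div_le_one hN0).2 (by exact_mod_cast hk)⟩
    intro k
    induction k with
    | zero => intro _ s _; simp [hD]
    | succ k ih =>
      intro hk
      refine hstep _ (hmem k (by omega)) (ih (by omega)) _ (hmem _ hk) ?_
      have : (k : ℝ) / N - ((k + 1 : ℕ) : ℝ) / N = -(1 / N) := by
        push_cast
        field_simp
        ring
      rw [this, abs_neg, abs_of_pos (by positivity)]
      exact (one_div_lt hδ hN0).1 hN
  have := hind N le_rfl s hs
  rw [div_self hN0.ne'] at this
  simpa [hD] using this

/-- The gain/phase condition on nonnegative frequencies makes the return difference invertible on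
the closed right half-plane and at infinity. -/
lemma det_return_difference_ne_zero {H₁ H₂ : TransferMatrix n} (h₁ : IsRHInf H₁) (h₂ : IsRHInf H₂)
    (h : ∀ ω : ℝ≥0∞,
      alphaMax (freqResponse H₁ ω) + alphaMax (freqResponse H₂ ω) < Real.pi ∨
      sigmaMax (freqResponse H₁ ω) * sigmaMax (freqResponse H₂ ω) < 1) :
    (∀ s ∈ closedRHP, (1 + evalAt H₂ s * evalAt H₁ s).det ≠ 0) ∧
      (1 + valueAtInfinity H₂ * valueAtInfinity H₁).det ≠ 0 := by
  have hinf : ∀ t ∈ Set.Icc (0 : ℝ) 1,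
      (1 + (t : ℂ) • (valueAtInfinity H₂ * valueAtInfinity H₁)).det ≠ 0 := fun t ht =>
    det_one_add_smul_mul_ne_zero _ _ (by simpa [freqResponse] using h ∞) ht
  have hpos : ∀ t ∈ Set.Icc (0 : ℝ) 1, ∀ ω : ℝ, 0 ≤ ω →
      (1 + (t : ℂ) • (evalAt H₂ (ω * I) * evalAt H₁ (ω * I))).det ≠ 0 := fun t ht ω hω =>
    det_one_add_smul_mul_ne_zero _ _
      (by simpa [freqResponse, hω, mul_comm I] using h (ENNReal.ofReal ω)) ht
  refine ⟨fun s hs => ?_, by simpa using hinf 1 (by simp)⟩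
  refine det_one_add_ne_zero_of_imaginary (h₁.isProperStable_mul h₂)
    (h₂.tendsto_evalAt.mul h₁.tendsto_evalAt) (fun t ht ω => ?_) hinf hs
  rcases le_total 0 ω with hω | hω
  · exact hpos t ht ω hω
  -- For negative `ω` the determinant is the conjugate of the one at `-ω`.
  · have hc : (ω : ℂ) * I = starRingEnd ℂ (((-ω : ℝ) : ℂ) * I) := by simp
    have h2 := hpos t ht (-ω) (by linarith)
    intro h0
    apply h2
    rw [hc, evalAt_conj, evalAt_conj, ← Matrix.map_mul] at h0
    have h3 : ∀ A : Matrix (Fin n) (Fin n) ℂ, 1 + (t : ℂ) • A.map (starRingEnd ℂ) =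
        (starRingEnd ℂ).mapMatrix (1 + (t : ℂ) • A) := by
      intro A
      ext i j
      simp [Matrix.one_apply, apply_ite (starRingEnd ℂ)]
    rw [h3, ← RingHom.map_det] at h0
    simpa using h0

end

section

open Complex Filter Topology MeasureTheory Set

/-! ### Laplace transforms of scalar signals -/

/-- The Laplace transform of a scalar signal. -/
noncomputable def scalarLaplace (u : ℝ → ℂ) (s : ℂ) : ℂ :=
  ∫ t, exp (-(s * (t : ℂ))) * u t ∂timeMeasure

lemma memLp_exp_timeMeasure {s : ℂ} (hs : 0 < s.re) :
    MemLp (fun t : ℝ => exp (-(s * (t : ℂ)))) 2 timeMeasure := by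
  rw [memLp_two_iff_integrable_sq_norm (by fun_prop)]
  have := (integrableOn_Ici_iff_integrableOn_Ioi).2
    (integrableOn_exp_mul_Ioi (a := -(2 * s.re)) (by linarith) 0)
  refine this.congr (ae_of_all _ fun t => ?_)
  simp only [norm_exp, ← Real.exp_nat_mul]
  congr 1
  simp
  ring

lemma integrable_exp_mul {u : ℝ → ℂ} (hu : MemLp u 2 timeMeasure) {s : ℂ} (hs : 0 < s.re) :
    Integrable (fun t : ℝ => exp (-(s * (t : ℂ))) * u t) timeMeasure :=
  (memLp_exp_timeMeasure hs).integrable_mul hu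

lemma scalarLaplace_add {u v : ℝ → ℂ} (hu : MemLp u 2 timeMeasure) (hv : MemLp v 2 timeMeasure)
    {s : ℂ} (hs : 0 < s.re) :
    scalarLaplace (fun t => u t + v t) s = scalarLaplace u s + scalarLaplace v s := by
  simp only [scalarLaplace, mul_add]
  exact integral_add (integrable_exp_mul hu hs) (integrable_exp_mul hv hs)

lemma scalarLaplace_sub {u v : ℝ → ℂ} (hu : MemLp u 2 timeMeasure) (hv : MemLp v 2 timeMeasure)
    {s : ℂ} (hs : 0 < s.re) :
    scalarLaplace (fun t => u t - v t) s = scalarLaplace u s - scalarLaplace v s := by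
  simp only [scalarLaplace, mul_sub]
  exact integral_sub (integrable_exp_mul hu hs) (integrable_exp_mul hv hs)

lemma scalarLaplace_sum {ι : Type*} (S : Finset ι) {u : ι → ℝ → ℂ}
    (hu : ∀ i ∈ S, MemLp (u i) 2 timeMeasure) {s : ℂ} (hs : 0 < s.re) :
    scalarLaplace (fun t => ∑ i ∈ S, u i t) s = ∑ i ∈ S, scalarLaplace (u i) s := by
  simp only [scalarLaplace, Finset.mul_sum]
  exact integral_finsetSum S fun i hi => integrable_exp_mul (hu i hi) hs

lemma scalarLaplace_const_mul (c : ℂ) (u : ℝ → ℂ) (s : ℂ) :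
    scalarLaplace (fun t => c * u t) s = c * scalarLaplace u s := by
  simp only [scalarLaplace, ← integral_const_mul]
  congr 1
  ext t
  ring

lemma scalarLaplace_congr {u v : ℝ → ℂ} (h : u =ᵐ[timeMeasure] v) (s : ℂ) :
    scalarLaplace u s = scalarLaplace v s := by
  refine integral_congr_ae ?_
  filter_upwards [h] with t ht
  rw [ht]

lemma scalarLaplace_conj (u : ℝ → ℂ) (s : ℂ) :
    scalarLaplace (fun t => starRingEnd ℂ (u t)) s =
      starRingEnd ℂ (scalarLaplace u (starRingEnd ℂ s)) := by
  rw [scalarLaplace, scalarLaplace, ← integral_conj]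
  congr 1
  ext t
  simp [← exp_conj]

/-! ### Injectivity of the Laplace transform -/

/-- Every test function `φ` is the Fourier transform of a Schwartz function `ψ`, so moving the
transform across the integral turns `∫ φ g` into `∫ ψ ĝ = 0`. -/
lemma ae_eq_zero_of_fourier_eq_zero {g : ℝ → ℂ} (hg : Integrable g)
    (h : ∀ ξ : ℝ, FourierTransform.fourier g ξ = 0) : ∀ᵐ x, g x = 0 := by
  refine ae_eq_zero_of_integral_contDiff_smul_eq_zero hg.locallyIntegrable fun φ hφ hφc => ?_
  have hΦc : HasCompactSupport fun x => (φ x : ℂ) := hφc.comp_left (g := ((↑) : ℝ → ℂ)) rfl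
  have hΦ : ContDiff ℝ (⊤ : ℕ∞) fun x => (φ x : ℂ) := ofRealCLM.contDiff.comp hφ
  set Φ : SchwartzMap ℝ ℂ := hΦc.toSchwartzMap hΦ with hΦdef
  set ψ : SchwartzMap ℝ ℂ := FourierTransformInv.fourierInv Φ with hψ
  have hψΦ : FourierTransform.fourier (ψ : ℝ → ℂ) = fun x => (φ x : ℂ) := by
    have : FourierTransform.fourier ψ = Φ := FourierTransform.fourier_fourierInv_eq Φ
    rw [← SchwartzMap.fourier_coe, this]
    rfl
  have key := VectorFourier.integral_fourierIntegral_smul_eq_flip (L := innerₗ ℝ)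
    (μ := volume) (ν := volume) Real.continuous_fourierChar continuous_inner
    ψ.integrable hg
  have h1 : ∀ x, VectorFourier.fourierIntegral Real.fourierChar volume (innerₗ ℝ) ψ x =
      (φ x : ℂ) := fun x => congrFun hψΦ x
  have h2 : ∀ x, VectorFourier.fourierIntegral Real.fourierChar volume (innerₗ ℝ).flip g x = 0 := by
    intro x
    rw [flip_innerₗ]
    exact h x
  simp only [h1, h2, smul_zero, integral_zero] at key
  exact_mod_cast key

lemma integral_timeMeasure {E : Type*} [NormedAddCommGroup E] [NormedSpace ℝ E] (f : ℝ → E) :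
    ∫ t, f t ∂timeMeasure = ∫ t, (Ici (0 : ℝ)).indicator f t :=
  (integral_indicator measurableSet_Ici).symm

/-- An `L₂` signal whose Laplace transform vanishes is zero. -/
lemma ae_eq_zero_of_scalarLaplace_eq_zero {u : ℝ → ℂ} (hu : MemLp u 2 timeMeasure)
    (h : ∀ s : ℂ, 0 < s.re → scalarLaplace u s = 0) : ∀ᵐ t ∂timeMeasure, u t = 0 := by
  -- The weight `e^{-t}` makes `u` integrable, and on the line `Re s = 1` the Laplace transform is
  -- the Fourier transform of `e^{-t} u`.
  have hint : Integrable ((Ici (0 : ℝ)).indicator fun t : ℝ => exp (-((1 : ℂ) * t)) * u t) :=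
    (integrable_indicator_iff measurableSet_Ici).2 (integrable_exp_mul hu (by simp))
  have h0 := ae_eq_zero_of_fourier_eq_zero hint fun ξ => by
    have h1 := h (1 + 2 * Real.pi * ξ * I) (by simp)
    rw [scalarLaplace, integral_timeMeasure] at h1
    rw [Real.fourier_real_eq_integral_exp_smul, ← h1]
    congr 1
    ext t
    by_cases ht : t ∈ Ici (0 : ℝ)
    · simp only [indicator_of_mem ht, smul_eq_mul, ← mul_assoc, ← exp_add]
      congr 2
      push_cast
      ring
    · simp [indicator_of_notMem ht]
  rw [timeMeasure, ae_restrict_iff' measurableSet_Ici]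
  filter_upwards [h0] with t ht hmem
  rw [indicator_of_mem hmem] at ht
  simpa using ht

lemma ae_eq_of_scalarLaplace_eq {u v : ℝ → ℂ} (hu : MemLp u 2 timeMeasure)
    (hv : MemLp v 2 timeMeasure) (h : ∀ s : ℂ, 0 < s.re → scalarLaplace u s = scalarLaplace v s) :
    u =ᵐ[timeMeasure] v := by
  filter_upwards [ae_eq_zero_of_scalarLaplace_eq_zero (hu.sub hv) fun s hs => by
    rw [← sub_eq_zero.2 (h s hs), ← scalarLaplace_sub hu hv hs]; rfl] with t ht
  exact sub_eq_zero.1 ht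

/-! ### Convolution bounds -/

/-- Cauchy–Schwarz for the splitting `a g = a^{1/2} · (a^{1/2} g)`. -/
lemma sq_lintegral_mul_le {α : Type*} [MeasurableSpace α] {μ : Measure α} {a g : α → ℝ≥0∞}
    (ha : AEMeasurable a μ) (hg : AEMeasurable g μ) :
    (∫⁻ x, a x * g x ∂μ) ^ 2 ≤ (∫⁻ x, a x ∂μ) * ∫⁻ x, a x * g x ^ 2 ∂μ := by
  have hsq : ∀ x : ℝ≥0∞, (x ^ (1 / 2 : ℝ)) ^ (2 : ℝ) = x := fun x => by
    rw [← ENNReal.rpow_mul]; norm_num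
  have hsq' : ∀ x : ℝ≥0∞, (x ^ (1 / 2 : ℝ)) ^ 2 = x := fun x => by
    rw [← ENNReal.rpow_two, hsq]
  have := ENNReal.lintegral_mul_le_Lp_mul_Lq μ Real.HolderConjugate.two_two
    (f := fun x => a x ^ (1 / 2 : ℝ)) (g := fun x => a x ^ (1 / 2 : ℝ) * g x)
    (ha.pow_const _) ((ha.pow_const _).mul hg)
  simp only [Pi.mul_apply, ENNReal.mul_rpow_of_nonneg _ _ (zero_le_two (α := ℝ)), hsq,
    ← mul_assoc, ← pow_two, hsq'] at this
  calc (∫⁻ x, a x * g x ∂μ) ^ 2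
      ≤ ((∫⁻ x, a x ∂μ) ^ (1 / 2 : ℝ) * (∫⁻ x, a x * g x ^ (2 : ℝ) ∂μ) ^ (1 / 2 : ℝ)) ^ 2 := by
        gcongr
    _ = _ := by rw [mul_pow, hsq', hsq']; simp

/-- Young's inequality for the convolution of an `L₁` and an `L₂` function. -/
lemma lintegral_sq_lintegral_mul_sub_le {a b : ℝ → ℝ≥0∞} (ha : Measurable a) (hb : Measurable b) :
    ∫⁻ t, (∫⁻ r, a r * b (t - r)) ^ 2 ≤ (∫⁻ r, a r) ^ 2 * ∫⁻ t, b t ^ 2 := by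
  have hm : Measurable fun x : ℝ × ℝ => a x.2 * b (x.1 - x.2) ^ 2 := by fun_prop
  calc ∫⁻ t, (∫⁻ r, a r * b (t - r)) ^ 2
      ≤ ∫⁻ t, (∫⁻ r, a r) * ∫⁻ r, a r * b (t - r) ^ 2 :=
        lintegral_mono fun t => sq_lintegral_mul_le (by fun_prop) (by fun_prop)
    _ = (∫⁻ r, a r) * ∫⁻ t, ∫⁻ r, a r * b (t - r) ^ 2 :=
        lintegral_const_mul _ hm.lintegral_prod_right'
    _ = (∫⁻ r, a r) * ∫⁻ r, ∫⁻ t, a r * b (t - r) ^ 2 := by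
        rw [lintegral_lintegral_swap hm.aemeasurable]
    _ = (∫⁻ r, a r) * ∫⁻ r, a r * ∫⁻ t, b t ^ 2 := by
        congr 1
        refine lintegral_congr fun r => ?_
        rw [lintegral_const_mul _ (by fun_prop),
          lintegral_sub_right_eq_self (fun t => b t ^ 2) r]
    _ = _ := by rw [lintegral_mul_const _ ha, ← mul_assoc, pow_two]

end

/-! ### Proper stable functions as bounded operators on scalar signals -/

section

open Complex Filter Topology MeasureTheory Set

/-- `φ` is the transfer function of a bounded operator on scalar `L₂` signals. -/
def IsRealizable (φ : ℂ → ℂ) : Prop :=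
  ∃ C : ℝ≥0, ∀ u : ℝ → ℂ, MemLp u 2 timeMeasure →
    ∃ y : ℝ → ℂ, MemLp y 2 timeMeasure ∧
      eLpNorm y 2 timeMeasure ≤ C * eLpNorm u 2 timeMeasure ∧
      ∀ s : ℂ, 0 < s.re → scalarLaplace y s = φ s * scalarLaplace u s

/-- The impulse response of `1 / (s - p)`. -/
noncomputable def expKernel (p : ℂ) : ℝ → ℂ :=
  (Ici (0 : ℝ)).indicator fun t => exp (p * t)

lemma integrable_expKernel {p : ℂ} (hp : p.re < 0) : Integrable (expKernel p) :=
  (integrable_indicator_iff measurableSet_Ici).2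
    ((integrableOn_Ici_iff_integrableOn_Ioi).2 (integrableOn_exp_mul_complex_Ioi hp 0))

lemma integral_expKernel {p : ℂ} (hp : p.re < 0) : ∫ t, expKernel p t = -1 / p := by
  rw [expKernel, integral_indicator measurableSet_Ici, integral_Ici_eq_integral_Ioi,
    integral_exp_mul_complex_Ioi hp]
  simp

lemma stronglyMeasurable_expKernel (p : ℂ) : StronglyMeasurable (expKernel p) :=
  StronglyMeasurable.indicator (by fun_prop) measurableSet_Ici

/-- The convolution of a signal on `[0, ∞)` with the exponential kernel. -/
noncomputable def expConv (p : ℂ) (u : ℝ → ℂ) (t : ℝ) : ℂ :=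
  ∫ r, expKernel p r * (Ici (0 : ℝ)).indicator u (t - r)

/-- Causality; it allows the Laplace integral of the output to be taken over all of `ℝ`. -/
lemma expConv_of_neg (p : ℂ) (u : ℝ → ℂ) {t : ℝ} (ht : t < 0) : expConv p u t = 0 := by
  rw [expConv, ← integral_zero ℝ ℂ]
  congr 1
  ext r
  rcases lt_or_ge r 0 with hr | hr
  · rw [expKernel, indicator_of_notMem (by simpa using hr), zero_mul]
  · rw [indicator_of_notMem (by simp only [mem_Ici, not_le]; linarith), mul_zero]

lemma stronglyMeasurable_expConv (p : ℂ) {u : ℝ → ℂ} (hu : StronglyMeasurable u) :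
    StronglyMeasurable (expConv p u) := by
  have hk := (stronglyMeasurable_expKernel p).measurable
  have hu' := (hu.indicator (measurableSet_Ici (a := (0 : ℝ)))).measurable
  have : Measurable fun x : ℝ × ℝ => expKernel p x.2 * (Ici (0 : ℝ)).indicator u (x.1 - x.2) := by
    fun_prop
  exact this.stronglyMeasurable.integral_prod_right'

lemma eLpNorm_expConv_le (p : ℂ) {u : ℝ → ℂ} (hu : StronglyMeasurable u) :
    eLpNorm (expConv p u) 2 timeMeasure ≤
      (∫⁻ r, ‖expKernel p r‖ₑ) * eLpNorm u 2 timeMeasure := by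
  have hk := (stronglyMeasurable_expKernel p).measurable
  have hu' := (hu.indicator (measurableSet_Ici (a := (0 : ℝ)))).measurable
  have hsq : ∀ (v : ℝ → ℂ) (μ : Measure ℝ), eLpNorm v 2 μ ^ 2 = ∫⁻ t, ‖v t‖ₑ ^ 2 ∂μ := by
    intro v μ
    simpa using eLpNorm_nnreal_pow_eq_lintegral (p := 2) (f := v) (μ := μ) two_ne_zero
  rw [← ENNReal.pow_le_pow_left_iff two_ne_zero, mul_pow, timeMeasure,
    ← eLpNorm_indicator_eq_eLpNorm_restrict (f := u) measurableSet_Ici, hsq, hsq]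
  calc ∫⁻ t in Ici 0, ‖expConv p u t‖ₑ ^ 2
      ≤ ∫⁻ t, ‖expConv p u t‖ₑ ^ 2 := setLIntegral_le_lintegral _ _
    _ ≤ ∫⁻ t, (∫⁻ r, ‖expKernel p r‖ₑ * ‖(Ici (0 : ℝ)).indicator u (t - r)‖ₑ) ^ 2 := by
        refine lintegral_mono fun t => ?_
        gcongr
        refine (enorm_integral_le_lintegral_enorm _).trans_eq ?_
        simp only [enorm_mul]
    _ ≤ _ := lintegral_sq_lintegral_mul_sub_le hk.enorm hu'.enorm

/-- The factor `e^{-st}` splits as `e^{-sr} e^{-s(t-r)}`, so the weighted output is the convolution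
of the kernel for `p - s` with the weighted input, and the integral of a convolution is the product
of the integrals. -/
lemma scalarLaplace_expConv {p : ℂ} (hp : p.re < 0) {u : ℝ → ℂ} (hu : MemLp u 2 timeMeasure)
    {s : ℂ} (hs : 0 < s.re) :
    scalarLaplace (expConv p u) s = (s - p)⁻¹ * scalarLaplace u s := by
  have hps : (p - s).re < 0 := by simp; linarith
  have hint : Integrable ((Ici (0 : ℝ)).indicator fun t : ℝ => exp (-(s * t)) * u t) :=
    (integrable_indicator_iff measurableSet_Ici).2 (integrable_exp_mul hu hs)
  have hconv := integral_convolution (ContinuousLinearMap.mul ℝ ℂ) (μ := volume) (ν := volume)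
    (integrable_expKernel hps) hint
  rw [integral_expKernel hps, ← integral_timeMeasure] at hconv
  have hrhs : (s - p)⁻¹ * scalarLaplace u s = ContinuousLinearMap.mul ℝ ℂ (-1 / (p - s))
      (∫ t, exp (-(s * (t : ℂ))) * u t ∂timeMeasure) := by
    have : -1 / (p - s) = (s - p)⁻¹ := by rw [← neg_sub s p, neg_div_neg_eq, one_div]
    rw [this]
    rfl
  rw [hrhs, ← hconv, scalarLaplace, timeMeasure,
    setIntegral_eq_integral_of_forall_compl_eq_zero fun t ht => by
      rw [expConv_of_neg p u (by simpa using ht), mul_zero]]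
  congr 1
  ext t
  rw [convolution, expConv, ← integral_const_mul]
  congr 1
  ext r
  rw [ContinuousLinearMap.mul_apply']
  by_cases hr : r ∈ Ici (0 : ℝ)
  · by_cases htr : t - r ∈ Ici (0 : ℝ)
    · rw [expKernel, expKernel, indicator_of_mem hr, indicator_of_mem htr, indicator_of_mem hr,
        indicator_of_mem htr, ← mul_assoc, ← mul_assoc, ← exp_add, ← exp_add]
      congr 2
      push_cast
      ring
    · rw [indicator_of_notMem htr, indicator_of_notMem htr, mul_zero, mul_zero, mul_zero]
  · rw [expKernel, expKernel, indicator_of_notMem hr, indicator_of_notMem hr, zero_mul, zero_mul,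
      mul_zero]

namespace IsRealizable

variable {φ ψ : ℂ → ℂ}

lemma congr (h : IsRealizable φ) (hφψ : ∀ s : ℂ, 0 < s.re → φ s = ψ s) : IsRealizable ψ := by
  obtain ⟨C, hC⟩ := h
  refine ⟨C, fun u hu => ?_⟩
  obtain ⟨y, hy, hn, hl⟩ := hC u hu
  exact ⟨y, hy, hn, fun s hs => by rw [hl s hs, hφψ s hs]⟩

lemma const (c : ℂ) : IsRealizable fun _ => c := by
  refine ⟨‖c‖₊, fun u hu => ⟨fun t => c * u t, hu.const_mul c, ?_,
    fun s _ => scalarLaplace_const_mul c u s⟩⟩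
  exact (eLpNorm_const_smul_le (c := c) (f := u)).trans_eq rfl

lemma add (hφ : IsRealizable φ) (hψ : IsRealizable ψ) : IsRealizable fun s => φ s + ψ s := by
  obtain ⟨C, hC⟩ := hφ
  obtain ⟨C', hC'⟩ := hψ
  refine ⟨C + C', fun u hu => ?_⟩
  obtain ⟨y, hy, hn, hl⟩ := hC u hu
  obtain ⟨y', hy', hn', hl'⟩ := hC' u hu
  refine ⟨fun t => y t + y' t, hy.add hy', ?_, fun s hs => ?_⟩
  · refine (eLpNorm_add_le hy.1 hy'.1 one_le_two).trans ?_
    push_cast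
    rw [add_mul]
    gcongr
  · rw [scalarLaplace_add hy hy' hs, hl s hs, hl' s hs, add_mul]

lemma mul (hφ : IsRealizable φ) (hψ : IsRealizable ψ) : IsRealizable fun s => φ s * ψ s := by
  obtain ⟨C, hC⟩ := hφ
  obtain ⟨C', hC'⟩ := hψ
  refine ⟨C * C', fun u hu => ?_⟩
  obtain ⟨y', hy', hn', hl'⟩ := hC' u hu
  obtain ⟨y, hy, hn, hl⟩ := hC y' hy'
  refine ⟨y, hy, ?_, fun s hs => ?_⟩
  · refine hn.trans ?_
    push_cast
    rw [mul_assoc]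
    gcongr
  · rw [hl s hs, hl' s hs, mul_assoc]

lemma inv_sub {p : ℂ} (hp : p.re < 0) : IsRealizable fun s => (s - p)⁻¹ := by
  have hfin : ∫⁻ r, ‖expKernel p r‖ₑ ≠ ∞ := (integrable_expKernel hp).2.ne
  refine ⟨(∫⁻ r, ‖expKernel p r‖ₑ).toNNReal, fun u hu => ?_⟩
  -- The convolution estimates need a genuinely measurable representative.
  set v := hu.1.mk u
  have huv : u =ᵐ[timeMeasure] v := hu.1.ae_eq_mk
  have hv : MemLp v 2 timeMeasure := hu.ae_eq huv
  have hvm : StronglyMeasurable v := hu.1.stronglyMeasurable_mk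
  have hle := eLpNorm_expConv_le p hvm
  refine ⟨expConv p v, ⟨(stronglyMeasurable_expConv p hvm).aestronglyMeasurable, ?_⟩, ?_,
    fun s hs => ?_⟩
  · exact hle.trans_lt (ENNReal.mul_lt_top hfin.lt_top hv.2)
  · rw [ENNReal.coe_toNNReal hfin, eLpNorm_congr_ae huv]
    exact hle
  · rw [scalarLaplace_expConv hp hv hs, scalarLaplace_congr huv]

/-- Induction on the poles, for all numerators at once: `p = p(r) + (X - r) p₁` splits off one pole,
leaving `p₁` and `1` over the remaining ones. Repeated poles need no separate treatment. -/
lemma eval_div_prod (R : Multiset ℂ) (hR : ∀ r ∈ R, r.re < 0) :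
    ∀ p : Polynomial ℂ, p.natDegree ≤ R.card →
      IsRealizable fun s => p.eval s * (R.map fun r => (s - r)⁻¹).prod := by
  induction R using Multiset.induction_on with
  | empty =>
    intro p hp
    rw [Polynomial.eq_C_of_natDegree_eq_zero (Nat.le_zero.1 hp)]
    simpa using const _
  | cons r R ih =>
    intro p hp
    have hr : r.re < 0 := hR r (Multiset.mem_cons_self r R)
    have ih' := ih fun r' hr' => hR r' (Multiset.mem_cons_of_mem hr')
    have hdeg : (p /ₘ (Polynomial.X - Polynomial.C r)).natDegree ≤ R.card := by
      rw [Polynomial.natDegree_divByMonic _ (Polynomial.monic_X_sub_C r),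
        Polynomial.natDegree_X_sub_C]
      rw [Multiset.card_cons] at hp
      omega
    have h1 := (ih' _ hdeg).add (((const (p.eval r)).mul (inv_sub hr)).mul (ih' 1 (by simp)))
    refine h1.congr fun s hs => ?_
    have hne : s - r ≠ 0 := by
      intro h0
      have := congrArg re h0
      simp at this
      linarith
    have hp' := congrArg (Polynomial.eval s)
      (Polynomial.modByMonic_add_div p (Polynomial.X - Polynomial.C r))
    rw [Polynomial.modByMonic_X_sub_C_eq_C_eval] at hp'
    simp only [Polynomial.eval_add, Polynomial.eval_mul, Polynomial.eval_sub, Polynomial.eval_C,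
      Polynomial.eval_X] at hp'
    rw [Multiset.map_cons, Multiset.prod_cons, ← hp', Polynomial.eval_one]
    field_simp
    ring

end IsRealizable

lemma IsProperStable.isRealizable {φ : ℂ → ℂ} (hφ : IsProperStable φ) : IsRealizable φ := by
  obtain ⟨p, q, hd, hq, h⟩ := hφ
  have hq0 := ne_zero_of_eval_ne_zero hq
  have hroots : ∀ r ∈ q.roots, r.re < 0 := fun r hr => by
    by_contra hr'
    exact hq r (not_lt.1 hr') (Polynomial.isRoot_of_mem_roots hr)
  have hs := IsAlgClosed.splits q
  have h1 := (IsRealizable.const q.leadingCoeff⁻¹).mul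
    (IsRealizable.eval_div_prod q.roots hroots p (by rwa [hs.natDegree_eq_card_roots] at hd))
  refine h1.congr fun s hs' => ?_
  have hs' : s ∈ closedRHP := le_of_lt hs'
  have heval : q.eval s = q.leadingCoeff * (q.roots.map fun r => s - r).prod := by
    conv_lhs => rw [hs.eq_prod_roots]
    simp [Polynomial.eval_multiset_prod]
  rw [h s hs', heval, Multiset.prod_map_inv]
  field_simp

end

section

open Complex Filter Topology MeasureTheory Set

/-! ### Vector signals over `F = ℝ` or `F = ℂ` -/

section Scalars

variable {F : Type} [RCLike F]

/-- The inclusion `F ⊆ ℂ`. -/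
def toComplex (x : F) : ℂ := ((RCLike.re x : ℝ) : ℂ) + ((RCLike.im x : ℝ) : ℂ) * I

/-- The map `ℂ → F` given by the identity for `F = ℂ` and by the real part for `F = ℝ`. -/
def ofComplex (F : Type) [RCLike F] (z : ℂ) : F := (z.re : F) + (z.im : F) * RCLike.I

lemma continuous_toComplex : Continuous (toComplex : F → ℂ) := by
  unfold toComplex
  fun_prop

lemma continuous_ofComplex : Continuous (ofComplex F) := by
  unfold ofComplex
  fun_prop

@[simp] lemma re_toComplex (x : F) : (toComplex x).re = RCLike.re x := by simp [toComplex]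

@[simp] lemma im_toComplex (x : F) : (toComplex x).im = RCLike.im x := by simp [toComplex]

lemma toComplex_sub (x y : F) : toComplex (x - y) = toComplex x - toComplex y := by
  apply Complex.ext <;> simp

lemma toComplex_injective : Function.Injective (toComplex : F → ℂ) := by
  intro x y h
  refine RCLike.ext ?_ ?_
  · simpa using congrArg re h
  · simpa using congrArg im h

lemma norm_toComplex (x : F) : ‖toComplex x‖ = ‖x‖ := by
  rw [← sq_eq_sq₀ (norm_nonneg _) (norm_nonneg _), ← normSq_eq_norm_sq, ← RCLike.normSq_eq_def',
    normSq_apply, RCLike.normSq_apply, re_toComplex, im_toComplex]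

/-- Either `F` is `ℂ`, or it is `ℝ`. -/
lemma forall_toComplex_ofComplex (F : Type) [RCLike F] :
    (∀ z, toComplex (ofComplex F z) = z) ∨
      (∀ z, toComplex (ofComplex F z) = (1 / 2) * (z + starRingEnd ℂ z)) := by
  rcases RCLike.I_eq_zero_or_im_I_eq_one (K := F) with h | h
  · right
    intro z
    apply Complex.ext <;> simp [ofComplex, h]
    ring
  · left
    intro z
    apply Complex.ext <;> simp [ofComplex, h]

lemma ofComplex_toComplex (x : F) : ofComplex F (toComplex x) = x := by
  rw [ofComplex, re_toComplex, im_toComplex, RCLike.re_add_im]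

lemma norm_ofComplex_le (z : ℂ) : ‖ofComplex F z‖ ≤ ‖z‖ := by
  rw [← norm_toComplex]
  rcases forall_toComplex_ofComplex F with h | h
  · rw [h]
  · rw [h, norm_mul]
    have := norm_add_le z (starRingEnd ℂ z)
    rw [RCLike.norm_conj] at this
    norm_num
    linarith

variable {n : ℕ}

/-- The components of a vector signal, as complex signals. -/
def component (u : ℝ → EuclideanSpace F (Fin n)) (i : Fin n) (t : ℝ) : ℂ := toComplex (u t i)

lemma norm_component_le (u : ℝ → EuclideanSpace F (Fin n)) (i : Fin n) (t : ℝ) :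
    ‖component u i t‖ ≤ ‖u t‖ := by
  rw [component, norm_toComplex]
  exact PiLp.norm_apply_le (u t) i

lemma memLp_component {u : ℝ → EuclideanSpace F (Fin n)} (hu : MemLp u 2 timeMeasure)
    (i : Fin n) : MemLp (component u i) 2 timeMeasure := by
  refine hu.of_le ?_ (ae_of_all _ (norm_component_le u i))
  have : Continuous fun v : EuclideanSpace F (Fin n) => toComplex (v i) :=
    continuous_toComplex.comp (by fun_prop)
  exact this.comp_aestronglyMeasurable hu.1

lemma eLpNorm_component_le (u : ℝ → EuclideanSpace F (Fin n)) (i : Fin n) :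
    eLpNorm (component u i) 2 timeMeasure ≤ eLpNorm u 2 timeMeasure :=
  eLpNorm_mono (norm_component_le u i)

lemma laplace_apply {u : ℝ → EuclideanSpace F (Fin n)} (hu : MemLp u 2 timeMeasure) {s : ℂ}
    (hs : 0 < s.re) (i : Fin n) : laplace u s i = scalarLaplace (component u i) s :=
  eval_integral_piLp (f := fun t : ℝ => exp (-(s * (t : ℂ))) • toComplexVec (u t))
    (fun j => integrable_exp_mul (memLp_component hu j) hs) i

lemma laplace_sub {u v : ℝ → EuclideanSpace F (Fin n)} (hu : MemLp u 2 timeMeasure)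
    (hv : MemLp v 2 timeMeasure) {s : ℂ} (hs : 0 < s.re) :
    laplace (fun t => u t - v t) s = laplace u s - laplace v s := by
  ext i
  have huv : MemLp (fun t => u t - v t) 2 timeMeasure := hu.sub hv
  rw [PiLp.sub_apply, laplace_apply huv hs, laplace_apply hu hs, laplace_apply hv hs,
    ← scalarLaplace_sub (memLp_component hu i) (memLp_component hv i) hs]
  congr 1
  ext t
  simp only [component, PiLp.sub_apply, toComplex_sub]

lemma laplace_congr {u v : ℝ → EuclideanSpace F (Fin n)} (h : u =ᵐ[timeMeasure] v) (s : ℂ) :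
    laplace u s = laplace v s := by
  refine integral_congr_ae ?_
  filter_upwards [h] with t ht
  rw [ht]

lemma ae_eq_of_laplace_eq {u v : ℝ → EuclideanSpace F (Fin n)} (hu : MemLp u 2 timeMeasure)
    (hv : MemLp v 2 timeMeasure) (h : ∀ s : ℂ, 0 < s.re → laplace u s = laplace v s) :
    u =ᵐ[timeMeasure] v := by
  have : ∀ i, component u i =ᵐ[timeMeasure] component v i := fun i =>
    ae_eq_of_scalarLaplace_eq (memLp_component hu i) (memLp_component hv i) fun s hs => by
      rw [← laplace_apply hu hs, ← laplace_apply hv hs, h s hs]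
  filter_upwards [ae_all_iff.2 this] with t ht
  ext i
  exact toComplex_injective (ht i)

lemma norm_le_sum_norm (v : EuclideanSpace F (Fin n)) : ‖v‖ ≤ ∑ i, ‖v i‖ := by
  conv_lhs => rw [← (EuclideanSpace.basisFun (Fin n) F).sum_repr v]
  refine (norm_sum_le _ _).trans (Finset.sum_le_sum fun i _ => ?_)
  rw [norm_smul, OrthonormalBasis.norm_eq_one, mul_one]
  rfl

end Scalars

/-! ### Matrix responses and the closed loop -/

variable {n : ℕ}

/-- A stable proper transfer matrix acts boundedly on families of scalar `L₂` signals. -/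
lemma exists_scalar_response {G : ℂ → Matrix (Fin n) (Fin n) ℂ}
    (hG : ∀ i j, IsProperStable fun s => G s i j) :
    ∃ C : ℝ≥0, ∀ (u : Fin n → ℝ → ℂ) (K : ℝ≥0∞), (∀ i, MemLp (u i) 2 timeMeasure) →
      (∀ i, eLpNorm (u i) 2 timeMeasure ≤ K) →
      ∃ y : Fin n → ℝ → ℂ, (∀ i, MemLp (y i) 2 timeMeasure) ∧
        (∀ i, eLpNorm (y i) 2 timeMeasure ≤ C * K) ∧
        ∀ s : ℂ, 0 < s.re → ∀ i,
          scalarLaplace (y i) s = ∑ j, G s i j * scalarLaplace (u j) s := by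
  choose C hC using fun i j => (hG i j).isRealizable
  -- Row `i` only needs `∑ j, C i j`; summing over `i` too gives one constant for all rows.
  refine ⟨∑ i, ∑ j, C i j, fun u K hu hK => ?_⟩
  choose y hy hn hl using fun i j => hC i j (u j) (hu j)
  refine ⟨fun i t => ∑ j, y i j t, fun i => memLp_finsetSum _ fun j _ => hy i j, fun i => ?_,
    fun s hs i => ?_⟩
  · have h1 : (fun t => ∑ j, y i j t) = ∑ j, y i j := by ext t; simp
    calc eLpNorm (fun t => ∑ j, y i j t) 2 timeMeasure
        = eLpNorm (∑ j, y i j) 2 timeMeasure := by rw [h1]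
      _ ≤ ∑ j, eLpNorm (y i j) 2 timeMeasure :=
          eLpNorm_sum_le (fun j _ => (hy i j).1) one_le_two
      _ ≤ ∑ j, (C i j : ℝ≥0∞) * K := 
          Finset.sum_le_sum fun j _ => (hn i j).trans (by gcongr; exact hK j)
      _ = ((∑ j, C i j : ℝ≥0) : ℝ≥0∞) * K := by push_cast; rw [Finset.sum_mul]
      _ ≤ _ := by
        refine mul_le_mul' (ENNReal.coe_le_coe.2 ?_) le_rfl
        exact Finset.single_le_sum (f := fun i => ∑ j, C i j) (fun _ _ => zero_le)
          (Finset.mem_univ i)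
  · rw [scalarLaplace_sum _ (fun j _ => hy i j) hs]
    exact Finset.sum_congr rfl fun j _ => hl i j s hs

/-- A stable proper transfer matrix with real coefficients acts boundedly on `L₂` signals. -/
lemma exists_response (F : Type) [RCLike F] {G : ℂ → Matrix (Fin n) (Fin n) ℂ}
    (hG : ∀ i j, IsProperStable fun s => G s i j)
    (hconj : ∀ s, G (starRingEnd ℂ s) = (G s).map (starRingEnd ℂ)) :
    ∃ C : ℝ≥0, ∀ u : ℝ → EuclideanSpace F (Fin n), MemLp u 2 timeMeasure →
      ∃ y : ℝ → EuclideanSpace F (Fin n), MemLp y 2 timeMeasure ∧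
        eLpNorm y 2 timeMeasure ≤ C * eLpNorm u 2 timeMeasure ∧
        ∀ s : ℂ, 0 < s.re → laplace y s = Matrix.toEuclideanLin (G s) (laplace u s) := by
  obtain ⟨C, hC⟩ := exists_scalar_response hG
  -- The factor `n` comes from bounding the Euclidean norm by the sum of the `n` coordinate norms.
  refine ⟨n * C, fun u hu => ?_⟩
  obtain ⟨y, hy, hn, hl⟩ := hC (component u) (eLpNorm u 2 timeMeasure) (memLp_component hu)
    (eLpNorm_component_le u)
  have hz : ∀ i, MemLp (fun t => ofComplex F (y i t)) 2 timeMeasure := fun i =>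
    (hy i).of_le (continuous_ofComplex.comp_aestronglyMeasurable (hy i).1)
      (ae_of_all _ fun t => norm_ofComplex_le _)
  have hY : MemLp (fun t => WithLp.toLp 2 fun i => ofComplex F (y i t)) 2 timeMeasure :=
    MemLp.of_eval_piLp hz
  refine ⟨_, hY, ?_, fun s hs => ?_⟩
  · have h1 : (fun t => ∑ i, ‖y i t‖) = ∑ i, fun t => ‖y i t‖ := by ext t; simp
    calc eLpNorm (fun t => WithLp.toLp 2 fun i => ofComplex F (y i t)) 2 timeMeasure
        ≤ eLpNorm (fun t => ∑ i, ‖y i t‖) 2 timeMeasure := by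
          refine eLpNorm_mono_real fun t => (norm_le_sum_norm _).trans ?_
          exact Finset.sum_le_sum fun i _ => norm_ofComplex_le _
      _ ≤ ∑ i, eLpNorm (fun t => ‖y i t‖) 2 timeMeasure := by
          rw [h1]
          exact eLpNorm_sum_le (fun i _ => (hy i).1.norm) one_le_two
      _ ≤ ∑ _i : Fin n, (C : ℝ≥0∞) * eLpNorm u 2 timeMeasure :=
          Finset.sum_le_sum fun i _ => (eLpNorm_norm (y i)).trans_le (hn i)
      _ = _ := by simp [mul_assoc]
  · ext i
    have hcoord : ∀ s : ℂ, 0 < s.re → (∑ j, G s i j * scalarLaplace (component u j) s) =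
        Matrix.toEuclideanLin (G s) (laplace u s) i := fun s hs => by
      simp [Matrix.toLpLin_apply, Matrix.mulVec, dotProduct, laplace_apply hu hs]
    rw [laplace_apply hY hs, ← hcoord s hs]
    rcases forall_toComplex_ofComplex F with h | h
    · rw [← hl s hs]
      congr 1
      ext t
      exact h _
    -- Here `ofComplex` takes the real part, whose transform is the mean of `ŷ(s)` and the conjugate
    -- of `ŷ` at the conjugate point. These agree, as `G` and the real input both respect
    -- conjugation.
    · have hcomp : component (fun t => WithLp.toLp 2 fun i => ofComplex F (y i t)) i =
          fun t => (1 / 2) * (y i t + starRingEnd ℂ (y i t)) := by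
        ext t
        exact h _
      have hs' : 0 < (starRingEnd ℂ s).re := by simpa using hs
      have hreal : ∀ j, starRingEnd ℂ (scalarLaplace (component u j) (starRingEnd ℂ s)) =
          scalarLaplace (component u j) s := fun j => by
        rw [← scalarLaplace_conj]
        congr 1
        ext t
        have hx := h (toComplex (u t j))
        rw [ofComplex_toComplex] at hx
        rw [component]
        linear_combination (-2) * hx
      have hstar : MemLp (fun t => starRingEnd ℂ (y i t)) 2 timeMeasure := (hy i).star
      rw [hcomp, scalarLaplace_const_mul, scalarLaplace_add (hy i) hstar hs,
        scalarLaplace_conj, hl s hs, hl _ hs', map_sum]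
      simp only [hconj, map_mul, hreal, Matrix.map_apply, conj_conj]
      ring

/-- The inverse of the return difference `1 + H₂ H₁`. -/
noncomputable def sensitivity (H₁ H₂ : TransferMatrix n) (s : ℂ) : Matrix (Fin n) (Fin n) ℂ :=
  (1 + evalAt H₂ s * evalAt H₁ s).det⁻¹ • (1 + evalAt H₂ s * evalAt H₁ s).adjugate

lemma sensitivity_conj (H₁ H₂ : TransferMatrix n) (s : ℂ) :
    sensitivity H₁ H₂ (starRingEnd ℂ s) = (sensitivity H₁ H₂ s).map (starRingEnd ℂ) := by
  have h : 1 + evalAt H₂ (starRingEnd ℂ s) * evalAt H₁ (starRingEnd ℂ s) =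
      (starRingEnd ℂ).mapMatrix (1 + evalAt H₂ s * evalAt H₁ s) := by
    rw [evalAt_conj, evalAt_conj, map_add, map_one, map_mul]
    rfl
  rw [sensitivity, sensitivity, h, ← RingHom.map_det, ← RingHom.map_adjugate]
  ext i j
  simp

/-- The determinant at infinity is well-posedness: its being nonzero keeps the reciprocal
determinant proper. -/
lemma IsRHInf.isProperStable_sensitivity {H₁ H₂ : TransferMatrix n} (h₁ : IsRHInf H₁)
    (h₂ : IsRHInf H₂) (hdet : ∀ s ∈ closedRHP, (1 + evalAt H₂ s * evalAt H₁ s).det ≠ 0)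
    (hinf : (1 + valueAtInfinity H₂ * valueAtInfinity H₁).det ≠ 0) (i j : Fin n) :
    IsProperStable fun s => sensitivity H₁ H₂ s i j := by
  have hM : ∀ i j, IsProperStable fun s => (1 + evalAt H₂ s * evalAt H₁ s) i j := fun i j => by
    simpa using IsProperStable.one_add_smul (h₁.isProperStable_mul h₂) 1 i j
  have hlim : Tendsto (fun s => (1 + evalAt H₂ s * evalAt H₁ s).det) (Bornology.cobounded ℂ)
      (𝓝 (1 + valueAtInfinity H₂ * valueAtInfinity H₁).det) :=
    ((continuous_id.matrix_det).tendsto _).comp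
      (tendsto_const_nhds.add (h₂.tendsto_evalAt.mul h₁.tendsto_evalAt))
  exact ((IsProperStable.det hM).inv hdet hinf (hlim.mono_left inf_le_left)).mul
    (IsProperStable.adjugate hM i j)

/-- The loop equation reads `(1 + H₂ H₁) e = u`. One direction gives existence of loop signals, the
other uniqueness. -/
lemma eq_sensitivity_apply_iff {H₁ H₂ : TransferMatrix n} {s : ℂ}
    (hdet : (1 + evalAt H₂ s * evalAt H₁ s).det ≠ 0) {e u : EuclideanSpace ℂ (Fin n)} :
    e = Matrix.toEuclideanLin (sensitivity H₁ H₂ s) u ↔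
      e = u - Matrix.toEuclideanLin (evalAt H₂ s) (Matrix.toEuclideanLin (evalAt H₁ s) e) := by
  set M := evalAt H₂ s * evalAt H₁ s with hM
  have hcomp : Matrix.toEuclideanLin (evalAt H₂ s) (Matrix.toEuclideanLin (evalAt H₁ s) e) =
      Matrix.toEuclideanLin M e := by
    simp [hM, Matrix.toLpLin_apply]
  have hr : (1 + M) * sensitivity H₁ H₂ s = 1 := by
    rw [sensitivity, Matrix.mul_smul, Matrix.mul_adjugate, smul_smul, inv_mul_cancel₀ hdet,
      one_smul]
  have hl : sensitivity H₁ H₂ s * (1 + M) = 1 := mul_eq_one_comm.1 hr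
  have happ : ∀ (A B : Matrix (Fin n) (Fin n) ℂ) (v : EuclideanSpace ℂ (Fin n)), A * B = 1 →
      Matrix.toEuclideanLin A (Matrix.toEuclideanLin B v) = v := by
    intro A B v h
    simp [Matrix.toLpLin_apply, h]
  have hadd : Matrix.toEuclideanLin (1 + M) e = e + Matrix.toEuclideanLin M e := by
    simp [Matrix.toLpLin_apply]
  rw [hcomp, eq_sub_iff_add_eq, ← hadd]
  constructor
  · rintro h
    rw [h, happ _ _ _ hr]
  · intro h
    rw [← h, happ _ _ _ hl]

lemma isL2StableOver (F : Type) [RCLike F] {H₁ H₂ : TransferMatrix n} (h₁ : IsRHInf H₁)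
    (h₂ : IsRHInf H₂) (hdet : ∀ s ∈ closedRHP, (1 + evalAt H₂ s * evalAt H₁ s).det ≠ 0)
    (hinf : (1 + valueAtInfinity H₂ * valueAtInfinity H₁).det ≠ 0) :
    IsL2StableOver F H₁ H₂ := by
  obtain ⟨C, hC⟩ := exists_response F (h₁.isProperStable_sensitivity h₂ hdet hinf)
    (sensitivity_conj H₁ H₂)
  obtain ⟨C₁, hC₁⟩ := exists_response F h₁.isProperStable (evalAt_conj H₁)
  have hdet' : ∀ s : ℂ, 0 < s.re → (1 + evalAt H₂ s * evalAt H₁ s).det ≠ 0 :=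
    fun s hs => hdet s hs.le
  refine ⟨C + C₁ * C, fun u hu => ?_⟩
  obtain ⟨e, he, hen, hel⟩ := hC u hu
  obtain ⟨y, hy, hyn, hyl⟩ := hC₁ e he
  -- Choosing `w = u - e` makes the summing junction hold identically, so only the transform
  -- identity `ŵ = H₂ ŷ` remains.
  refine ⟨e, y, ⟨he, hy, hyl, fun t => u t - e t, hu.sub he, fun s hs => ?_, ?_⟩, ?_, ?_, ?_⟩
  · have h := (eq_sensitivity_apply_iff (hdet' s hs)).1 (hel s hs)
    rw [laplace_sub hu he hs, hyl s hs, sub_eq_iff_eq_add, ← sub_eq_iff_eq_add', ← h]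
  · exact ae_of_all _ fun t => (sub_sub_cancel _ _).symm
  · refine hen.trans ?_
    gcongr
    exact_mod_cast le_self_add
  · refine (hyn.trans (mul_le_mul_right hen _)).trans ?_
    rw [← mul_assoc]
    gcongr
    exact_mod_cast le_add_self
  · rintro e' y' ⟨he', hy', hfwd, w, hw, hwl, hfb⟩
    have hle : ∀ s : ℂ, 0 < s.re → laplace e' s = laplace e s := fun s hs => by
      rw [hel s hs, eq_sensitivity_apply_iff (hdet' s hs), ← hfwd s hs, ← hwl s hs,
        ← laplace_sub hu hw hs]
      exact laplace_congr hfb s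
    refine ⟨ae_eq_of_laplace_eq he' he hle, ae_eq_of_laplace_eq hy' hy fun s hs => ?_⟩
    rw [hfwd s hs, hyl s hs, hle s hs]

end

end MixedGainPhase

theorem theorem5 (n : ℕ) (H₁ H₂ : MixedGainPhase.TransferMatrix n)
    (h₁ : MixedGainPhase.IsRHInf H₁) (h₂ : MixedGainPhase.IsRHInf H₂)
    (h : ∀ ω : ENNReal,
      MixedGainPhase.alphaMax (MixedGainPhase.freqResponse H₁ ω) +
          MixedGainPhase.alphaMax (MixedGainPhase.freqResponse H₂ ω) < Real.pi ∨
      MixedGainPhase.sigmaMax (MixedGainPhase.freqResponse H₁ ω) *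
          MixedGainPhase.sigmaMax (MixedGainPhase.freqResponse H₂ ω) < 1) :
    MixedGainPhase.IsClosedLoopL2Stable H₁ H₂ := by
  obtain ⟨hdet, hinf⟩ := MixedGainPhase.det_return_difference_ne_zero h₁ h₂ h
  exact ⟨MixedGainPhase.isL2StableOver ℝ h₁ h₂ hdet hinf,
    MixedGainPhase.isL2StableOver ℂ h₁ h₂ hdet hinf⟩
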